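/- **Theorem (main lower bound, PAC).** *Setting.* Let $\Pi$ and $\mathcal O$ be measurable spaces. A *model* is a Markov kernel $M:\Pi\to\Delta([0,1]\times\mathcal O)$; let $\mathcal M^+$ be the set of all models and $\mathcal M\subseteq\mathcal M^+$ a model class. Write $f^M(\pi)=\mathbb E_{(r,o)\sim M(\pi)}[r]$ and $g^M(\pi)=\sup_{\pi'\in\Pi}f^M(\pi')-f^M(\pi)$. A *PAC algorithm* with $T$ rounds consists of Markov kernels $q^{1},\dots,q^{T},p$: in round $t$ it draws $\pi^t\sim q^t(\cdot\mid\mathfrak H^{t-1})$ and observes $(r^t,o^t)\sim M(\pi^t)$, where $\mathfrak H^{t}=(\pi^i,r^i,o^i)_{i\le t}$; after round $T$ it outputs $\hat\pi\sim p(\cdot\mid\mathfrak H^T)$. Its expected risk under $M$ is $\mathbb E^{M}[\mathbf{Risk}(T)]=\mathbb E^{M}\big[\mathbb E_{\hat\pi\sim p(\cdot\mid\mathfrak H^T)}[g^M(\hat\pi)]\big]$. With the squared Hellinger distance $D_H^2(P,Q)=\int(\sqrt{dP/d\nu}-\sqrt{dQ/d\nu})^2\,d\nu$ ($\nu$ any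 common dominating measure), define for $\bar M\in\mathcal M^+$ and $\varepsilon\ge 0$ $$\mathrm{dec}^c_\varepsilon(\mathcal M,\bar M)=\inf_{p,q\in\Delta(\Pi)}\ \sup_{M\in\mathcal M}\Big\{\mathbb E_{\pi\sim p}[g^M(\pi)]\ :\ \mathbb E_{\pi\sim q}\big[D_H^2(M(\pi),\bar M(\pi))\big]\le\varepsilon^2\Big\},$$ where the supremum over an empty set is $0$, and $\mathrm{dec}^c_\varepsilon(\mathcal M)=\sup_{\bar M\in\mathrm{co}(\mathcal M)}\mathrm{dec}^c_\varepsilon(\mathcal M,\bar M)$, where $\mathrm{co}(\mathcal M)$ is the convex hull of $\mathcal M$. Let $$V(\mathcal M)=\sup_{M,M'\in\mathcal M}\ \sup_{\pi\in\Pi}\ \sup_{A}\frac{M(A\mid\pi)}{M'(A\mid\pi)}\ \vee\ e,\qquad C(T)=\log\big(T\wedge V(\mathcal M)\big),$$ where $A$ ranges over the measurable subsets of $[0,1]\times\mathcal O$, $a/0=\infty$ for $a>0$, and $0/0=0$. *Claim.* There are universal constants $c_0>0$ and $\kappa>0$ such that the following holds for all $\Pi$, $\mathcal O$, $\mathcal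 M$, all $c\in(0,c_0]$ and all integers $T\ge 2$. Put $\varepsilon_T=c/\sqrt{T\,C(T)}$, and suppose that $$\mathrm{dec}^c_{\varepsilon_T}(\mathcal M)\ \ge\ 48\sqrt2\cdot\varepsilon_T .$$ Then for every PAC algorithm with $T$ rounds there is a model $M\in\mathcal M$ with $$\mathbb E^{M}[\mathbf{Risk}(T)]\ \ge\ \kappa\cdot\sup_{\bar M\in\mathcal M^+}\mathrm{dec}^c_{\varepsilon_T}(\mathcal M\cup\{\bar M\},\bar M)\ \ge\ \kappa\cdot\mathrm{dec}^c_{\varepsilon_T}(\mathcal M).$$ -/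

import Mathlib

open MeasureTheory ProbabilityTheory
open scoped ENNReal NNReal

noncomputable section

/-! Interactive decision making with structured observations. Throughout, `X` is the decision space,
`O` the observation space, and rewards take values in `[0,1]` (`unitInterval`). -/

namespace DMSO

universe u v

/-- A model: a conditional distribution (Markov kernel) over reward-observation pairs given the
decision. The whole type is the class of all models with rewards in `[0,1]`. -/
abbrev Model (X : Type u) (O : Type v) [MeasurableSpace X] [MeasurableSpace O] : Type (max u v) :=
  {M : Kernel X (unitInterval × O) // IsMarkovKernel M}

instance {X : Type u} {O : Type v} [MeasurableSpace X] [MeasurableSpace O] (M : Model X O) :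
    IsMarkovKernel M.1 := M.2

/-- The histories `(π¹, (r¹, o¹)), …, (πᵗ, (rᵗ, oᵗ))` of length `t`, as an iterated product. -/
def History (X : Type u) (O : Type v) : ℕ → Type (max u v)
  | 0 => PUnit
  | t + 1 => History X O t × (X × (unitInterval × O))

/-- The product σ-algebra on histories. -/
instance History.instMeasurableSpace (X : Type u) (O : Type v)
    [MeasurableSpace X] [MeasurableSpace O] : (t : ℕ) → MeasurableSpace (History X O t)
  | 0 => inferInstanceAs (MeasurableSpace PUnit)
  | t + 1 =>
      letI := History.instMeasurableSpace X O t
      inferInstanceAs (MeasurableSpace (History X O t × (X × (unitInterval × O))))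

variable {X : Type u} {O : Type v} [MeasurableSpace X] [MeasurableSpace O]

/-- A PAC algorithm with `T` rounds. Given the history of the first `t` rounds, the next decision is
drawn from `explore t` (only `t < T` matters); after `T` rounds the final decision is drawn from
`output`, given the whole history. -/
structure PACAlgorithm (X : Type u) (O : Type v) [MeasurableSpace X] [MeasurableSpace O]
    (T : ℕ) where
  explore : (t : ℕ) → Kernel (History X O t) X
  explore_markov : ∀ t, IsMarkovKernel (explore t)
  output : Kernel (History X O T) X
  output_markov : IsMarkovKernel output

/-- The law of the history of the first `t` rounds when decisions are drawn according to `q` and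
the underlying model is `M`: given the history, draw a decision `π` from `q t`, and then draw the
reward and the observation from `M π`. -/
def historyLaw (q : (t : ℕ) → Kernel (History X O t) X) (M : Model X O) :
    (t : ℕ) → Measure (History X O t)
  | 0 => Measure.dirac PUnit.unit
  | t + 1 => (historyLaw q M t) ⊗ₘ ((q t) ⊗ₖ (Kernel.prodMkLeft (History X O t) M.1))

/-- The mean reward of a decision under a model. -/
def meanReward (M : Model X O) (x : X) : ℝ := ∫ z, (z.1 : ℝ) ∂(M.1 x)

/-- The suboptimality of a decision under a model. The optimal value is the supremum of the mean
reward, so an optimal decision need not exist. -/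
def gap (M : Model X O) (x : X) : ℝ := (⨆ y, meanReward M y) - meanReward M x

/-- The expected risk of a PAC algorithm under the model `M`. -/
def expectedRisk {T : ℕ} (alg : PACAlgorithm X O T) (M : Model X O) : ℝ :=
  ∫ h, (∫ x, gap M x ∂(alg.output h)) ∂(historyLaw alg.explore M T)

/-- The squared Hellinger distance `∫ (√(dP/dν) - √(dQ/dν))² dν`, with the common dominating measure
`ν = P + Q`. -/
def hellingerSq {Z : Type*} [MeasurableSpace Z] (P Q : Measure Z) : ℝ≥0∞ :=
  ∫⁻ z, ENNReal.ofReal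
    ((√(P.rnDeriv (P + Q) z).toReal - √(Q.rnDeriv (P + Q) z).toReal) ^ 2) ∂(P + Q)

/-- The expected squared Hellinger distance between two models for a decision drawn from `q`. -/
def expHellingerSq (q : Measure X) (M N : Model X O) : ℝ≥0∞ :=
  ∫⁻ x, hellingerSq (M.1 x) (N.1 x) ∂q

/-- The PAC constrained decision-estimation coefficient of the class `𝓜` with radius `ε` and
reference model `N`. The inner supremum is zero if no model of the class is feasible
(the supremum of the empty set of reals); otherwise it is one of a nonempty subset of `[0,1]`. -/
def decPAC (ε : ℝ) (𝓜 : Set (Model X O)) (N : Model X O) : ℝ :=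
  ⨅ pq : ProbabilityMeasure X × ProbabilityMeasure X,
    sSup {v : ℝ | ∃ M ∈ 𝓜, expHellingerSq (pq.2 : Measure X) M N ≤ ENNReal.ofReal (ε ^ 2) ∧
      v = ∫ x, gap M x ∂(pq.1 : Measure X)}

/-- The convex hull of a class of models: all finite mixtures of models in the class. -/
def modelHull (𝓜 : Set (Model X O)) : Set (Model X O) :=
  {N | ∃ (n : ℕ) (w : Fin n → ℝ≥0) (F : Fin n → Model X O),
    (∑ i, w i = 1) ∧ (∀ i, F i ∈ 𝓜) ∧ ∀ x, N.1 x = ∑ i, w i • (F i).1 x}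

/-- The PAC constrained decision-estimation coefficient of a class: the supremum over reference
models in the convex hull. -/
def decPACClass (ε : ℝ) (𝓜 : Set (Model X O)) : ℝ :=
  ⨆ N : modelHull 𝓜, decPAC ε 𝓜 N.1

/-- The supremum, over arbitrary reference models `N`, of the PAC constrained
decision-estimation coefficient of the class enlarged by `N`. -/
def decPACImproper (ε : ℝ) (𝓜 : Set (Model X O)) : ℝ :=
  ⨆ N : Model X O, decPAC ε (insert N 𝓜) N

/-- The largest likelihood ratio between models in the class, or `e` if that is larger. In `ℝ≥0∞`,
`a / 0 = ∞` for `a ≠ 0`, and `0 / 0 = 0`. -/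
def likelihoodRatioBound (𝓜 : Set (Model X O)) : ℝ≥0∞ :=
  (⨆ M ∈ 𝓜, ⨆ M' ∈ 𝓜, ⨆ x : X, ⨆ A : Set (unitInterval × O), ⨆ _ : MeasurableSet A,
    M.1 x A / M'.1 x A) ⊔ ENNReal.ofReal (Real.exp 1)

/-- The logarithm of the minimum of `T` and the likelihood ratio bound. -/
def logFactor (T : ℕ) (𝓜 : Set (Model X O)) : ℝ :=
  Real.log ((T : ℝ≥0∞) ⊓ likelihoodRatioBound 𝓜).toReal

/-- The radius `c / √(T · C(T))`. -/
def lowerRadius (c : ℝ) (T : ℕ) (𝓜 : Set (Model X O)) : ℝ :=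
  c / √((T : ℝ) * logFactor T 𝓜)

end DMSO

end

/-! Fix an algorithm, a reference model `N` nearly attaining the improper coefficient `D`, and a
decision `x₀` within `D / 10` of optimal for `N`. In the coefficient, take `p` to be the point mass
at `x₀`, and `q` the mixture `referenceLaw` of the algorithm's exploration under `N`, its output
under `N`, and `x₀`. Some feasible `M` then has gap above `9 / 10 * D` at `x₀`; it differs from `N`,
so it lies in the class. If the risk under `M` were at most `D / 32`, the output under `M` would
mostly be good for `M`. Since `M` and `N` are hard to distinguish, the output under `N` would also
often be good for `M`, and by feasibility some such decision has nearly the same reward under both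
models. As `x₀` is nearly optimal for `N` and its rewards nearly agree too, it would be good for
`M`, a contradiction (`lt_expectedRisk_of_lt_decPAC`).

Indistinguishability is `testing_lower_bound`. Every expectation stays under `N`: for the likelihood
process `l`, the Le Cam affinity `E_N[l / (1 + l)]` starts at `1 / 2`, loses in each round at most a
constant times the Hellinger cost of that round under `N`
(`IsLikelihoodRatio.lintegral_leCam_step`), and bounds the total testing error from below. No
logarithm is lost, so of the log factor only the lower bound `log 2` is used.

The map `x ↦ hellingerSq (M x) (N x)` need not be measurable, nor need the kernels have a jointly
measurable density. Hence the variational form of the Hellinger distance and likelihood ratios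
relative to a fixed decision law `σ`. -/

namespace DMSO

/-! ### Inequalities for the squared Hellinger distance -/

section Hellinger

variable {Z : Type*} [MeasurableSpace Z]

lemma hellingerSq_comm (P Q : Measure Z) : hellingerSq P Q = hellingerSq Q P := by
  unfold hellingerSq
  rw [add_comm Q P]
  congr 1
  funext z
  congr 1
  ring

lemma lintegral_eq_lintegral_rnDeriv_add_left (P Q : Measure Z) [IsFiniteMeasure P]
    [IsFiniteMeasure Q] {f : Z → ℝ≥0∞} (hf : Measurable f) :
    ∫⁻ z, f z ∂P
      = ∫⁻ z, f z * ENNReal.ofReal (P.rnDeriv (P + Q) z).toReal ∂(P + Q) := by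
  have h : P ≪ P + Q := Measure.AbsolutelyContinuous.rfl.add_right Q
  rw [← lintegral_rnDeriv_mul h hf.aemeasurable]
  refine lintegral_congr_ae ?_
  filter_upwards [P.rnDeriv_lt_top (P + Q)] with z hz
  rw [ENNReal.ofReal_toReal hz.ne, mul_comm]

lemma lintegral_eq_lintegral_rnDeriv_add_right (P Q : Measure Z) [IsFiniteMeasure P]
    [IsFiniteMeasure Q] {f : Z → ℝ≥0∞} (hf : Measurable f) :
    ∫⁻ z, f z ∂Q
      = ∫⁻ z, f z * ENNReal.ofReal (Q.rnDeriv (P + Q) z).toReal ∂(P + Q) := by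
  rw [add_comm P Q]
  exact lintegral_eq_lintegral_rnDeriv_add_left Q P hf

/-- AM-GM: `2√(pq) ≤ p / φ + φ q`. The values `0` and `∞` of `φ` are admitted because the optimal
`φ` takes them where one density vanishes. -/
lemma ofReal_add_le_hellinger_integrand {p q : ℝ} (hp : 0 ≤ p) (hq : 0 ≤ q) (φ : ℝ≥0∞) :
    ENNReal.ofReal p + ENNReal.ofReal q
      ≤ ENNReal.ofReal ((√p - √q) ^ 2) + (φ⁻¹ * ENNReal.ofReal p + φ * ENNReal.ofReal q) := by
  have hsq : (√p - √q) ^ 2 = p + q - 2 * (√p * √q) := by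
    nlinarith [Real.sq_sqrt hp, Real.sq_sqrt hq]
  rcases eq_or_ne φ 0 with rfl | h0
  · rcases hp.eq_or_lt with rfl | hp'
    · simp [Real.sq_sqrt hq]
    · simp [ENNReal.top_mul, hp']
  rcases eq_or_ne φ ∞ with rfl | htop
  · rcases hq.eq_or_lt with rfl | hq'
    · simp [Real.sq_sqrt hp]
    · simp [ENNReal.top_mul, hq']
  lift φ to ℝ≥0 using htop
  have hφ : (0 : ℝ) < φ := by
    have : φ ≠ 0 := by simpa using h0
    exact_mod_cast this.bot_lt
  have e1 : (φ : ℝ≥0∞) = ENNReal.ofReal (φ : ℝ) := by simp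
  rw [e1, ← ENNReal.ofReal_inv_of_pos hφ, ← ENNReal.ofReal_mul (by positivity),
    ← ENNReal.ofReal_mul (by positivity), ← ENNReal.ofReal_add (by positivity) (by positivity),
    ← ENNReal.ofReal_add (by positivity) (by positivity),
    ← ENNReal.ofReal_add (by positivity) (by positivity)]
  refine ENNReal.ofReal_le_ofReal ?_
  rw [hsq]
  have key : 2 * (√p * √q) ≤ (φ : ℝ)⁻¹ * p + φ * q := by
    have h1 : (0 : ℝ) ≤ (φ : ℝ)⁻¹ * (√p - φ * √q) ^ 2 := by positivity
    have h2 : (φ : ℝ)⁻¹ * (√p - φ * √q) ^ 2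
        = (φ : ℝ)⁻¹ * (√p) ^ 2 - 2 * (√p * √q) + φ * (√q) ^ 2 := by
      field_simp
      ring
    rw [h2, Real.sq_sqrt hp, Real.sq_sqrt hq] at h1
    linarith
  linarith

/-- The variational lower bound on the squared Hellinger distance. -/
lemma two_le_hellingerSq_add (P Q : Measure Z) [IsProbabilityMeasure P] [IsProbabilityMeasure Q]
    {φ : Z → ℝ≥0∞} (hφ : Measurable φ) :
    2 ≤ hellingerSq P Q + (∫⁻ z, (φ z)⁻¹ ∂P + ∫⁻ z, φ z ∂Q) := by
  have hP := lintegral_eq_lintegral_rnDeriv_add_left P Q (f := fun _ => 1) measurable_const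
  have hQ := lintegral_eq_lintegral_rnDeriv_add_right P Q (f := fun _ => 1) measurable_const
  simp only [lintegral_const, measure_univ, mul_one, one_mul] at hP hQ
  rw [lintegral_eq_lintegral_rnDeriv_add_left P Q (f := fun z => (φ z)⁻¹) hφ.inv,
    lintegral_eq_lintegral_rnDeriv_add_right P Q hφ]
  have h2 : (2 : ℝ≥0∞) = 1 + 1 := by norm_num
  rw [h2]
  nth_rw 1 [hP]
  rw [hQ, hellingerSq, ← lintegral_add_left (by fun_prop), ← lintegral_add_left (by fun_prop),
    ← lintegral_add_left (by fun_prop)]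
  exact lintegral_mono fun z =>
    ofReal_add_le_hellinger_integrand ENNReal.toReal_nonneg ENNReal.toReal_nonneg _

/-- Factor `p - q = (√p - √q)(√p + √q)` and apply Young's inequality with weight `s`, using `(√p +
√q)² ≤ 2(p + q)`. -/
lemma lintegral_le_add_hellingerSq (P Q : Measure Z) [IsProbabilityMeasure P]
    [IsProbabilityMeasure Q] {f : Z → ℝ} (hf : Measurable f) (hf0 : ∀ z, 0 ≤ f z)
    (hf1 : ∀ z, f z ≤ 1) {s : ℝ} (hs : 0 < s) :
    ∫⁻ z, ENNReal.ofReal (f z) ∂P ≤ ∫⁻ z, ENNReal.ofReal (f z) ∂Q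
      + (ENNReal.ofReal (1 / (2 * s)) * hellingerSq P Q + ENNReal.ofReal (2 * s)) := by
  have hP := lintegral_eq_lintegral_rnDeriv_add_left P Q (f := fun _ => 1) measurable_const
  have hQ := lintegral_eq_lintegral_rnDeriv_add_right P Q (f := fun _ => 1) measurable_const
  simp only [lintegral_const, measure_univ, mul_one, one_mul] at hP hQ
  have h2 : ENNReal.ofReal (2 * s) = ENNReal.ofReal s * 1 + ENNReal.ofReal s * 1 := by
    rw [mul_one, ← ENNReal.ofReal_add hs.le hs.le]
    ring_nf
  have hfm : Measurable fun z => ENNReal.ofReal (f z) := hf.ennreal_ofReal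
  rw [h2]
  nth_rw 1 [hP]
  rw [hQ, lintegral_eq_lintegral_rnDeriv_add_left P Q hfm,
    lintegral_eq_lintegral_rnDeriv_add_right P Q hfm, hellingerSq,
    ← lintegral_const_mul _ (by fun_prop), ← lintegral_const_mul _ (by fun_prop),
    ← lintegral_const_mul _ (by fun_prop), ← lintegral_add_left (by fun_prop),
    ← lintegral_add_left (by fun_prop), ← lintegral_add_left (by fun_prop)]
  refine lintegral_mono fun z => ?_
  generalize hp : (P.rnDeriv (P + Q) z).toReal = p
  generalize hq : (Q.rnDeriv (P + Q) z).toReal = q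
  have hp0 : 0 ≤ p := hp ▸ ENNReal.toReal_nonneg
  have hq0 : 0 ≤ q := hq ▸ ENNReal.toReal_nonneg
  have f0 := hf0 z
  have f1 := hf1 z
  simp only
  rw [← ENNReal.ofReal_mul f0, ← ENNReal.ofReal_mul f0, ← ENNReal.ofReal_mul (by positivity),
    ← ENNReal.ofReal_mul hs.le, ← ENNReal.ofReal_mul hs.le,
    ← ENNReal.ofReal_add (by positivity) (by positivity),
    ← ENNReal.ofReal_add (by positivity) (by positivity),
    ← ENNReal.ofReal_add (by positivity) (by positivity)]
  refine ENNReal.ofReal_le_ofReal ?_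
  have e1 : p - q = (√p - √q) * (√p + √q) := by
    nlinarith [Real.sq_sqrt hp0, Real.sq_sqrt hq0]
  have h3 : (√p - √q) * (√p + √q) ≤ 1 / (2 * s) * (√p - √q) ^ 2 + s / 2 * (√p + √q) ^ 2 := by
    have h4 : 0 ≤ 1 / (2 * s) * ((√p - √q) - s * (√p + √q)) ^ 2 := by positivity
    have h5 : 1 / (2 * s) * ((√p - √q) - s * (√p + √q)) ^ 2
        = 1 / (2 * s) * (√p - √q) ^ 2 + s / 2 * (√p + √q) ^ 2
          - (√p - √q) * (√p + √q) := by
      field_simp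
      ring
    linarith
  have h6 : (√p + √q) ^ 2 ≤ 2 * (p + q) := by
    nlinarith [Real.sq_sqrt hp0, Real.sq_sqrt hq0, sq_nonneg (√p - √q)]
  have h7 : s / 2 * (√p + √q) ^ 2 ≤ s * (p + q) := by nlinarith
  have h8 : 0 ≤ 1 / (2 * s) * (√p - √q) ^ 2 := by positivity
  have h9 : f z * (p - q) ≤ 1 / (2 * s) * (√p - √q) ^ 2 + s * (p + q) := by
    rcases le_total 0 (p - q) with h | h
    · nlinarith
    · have : f z * (p - q) ≤ 0 := mul_nonpos_of_nonneg_of_nonpos f0 h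
      have : 0 ≤ s * (p + q) := by positivity
      linarith
  linarith

end Hellinger

/-! ### Mean rewards and gaps -/

section MeanReward

universe u v

variable {X : Type u} {O : Type v} [MeasurableSpace X] [MeasurableSpace O]

lemma integrable_reward (M : Model X O) (x : X) :
    Integrable (fun z : unitInterval × O => (z.1 : ℝ)) (M.1 x) :=
  Integrable.of_bound (C := 1) (by fun_prop) (Filter.Eventually.of_forall fun z => by
    rw [Real.norm_of_nonneg z.1.2.1]; exact z.1.2.2)

lemma meanReward_nonneg (M : Model X O) (x : X) : 0 ≤ meanReward M x :=
  integral_nonneg fun z => z.1.2.1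

lemma meanReward_le_one (M : Model X O) (x : X) : meanReward M x ≤ 1 := by
  have := integral_mono (integrable_reward M x) (integrable_const (1 : ℝ)) fun z => z.1.2.2
  simpa [meanReward] using this

lemma measurable_meanReward (M : Model X O) : Measurable (meanReward M) :=
  (StronglyMeasurable.integral_kernel (κ := M.1)
    (f := fun z : unitInterval × O => (z.1 : ℝ))
    (by fun_prop : Measurable fun z : unitInterval × O => (z.1 : ℝ)).stronglyMeasurable).measurable

lemma bddAbove_range_meanReward (M : Model X O) : BddAbove (Set.range (meanReward M)) :=
  ⟨1, by rintro _ ⟨x, rfl⟩; exact meanReward_le_one M x⟩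

lemma gap_nonneg (M : Model X O) (x : X) : 0 ≤ gap M x :=
  sub_nonneg.2 (le_ciSup (bddAbove_range_meanReward M) x)

lemma gap_le_one (M : Model X O) (x : X) : gap M x ≤ 1 := by
  have : Nonempty X := ⟨x⟩
  have h1 : ⨆ y, meanReward M y ≤ 1 := ciSup_le fun y => meanReward_le_one M y
  have h2 := meanReward_nonneg M x
  unfold gap
  linarith

lemma measurable_gap (M : Model X O) : Measurable (gap M) :=
  (measurable_meanReward M).const_sub _

lemma integrable_gap (M : Model X O) (p : Measure X) [IsFiniteMeasure p] :
    Integrable (gap M) p :=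
  Integrable.of_bound (C := 1) (measurable_gap M).aestronglyMeasurable
    (Filter.Eventually.of_forall fun x => by
      rw [Real.norm_of_nonneg (gap_nonneg M x)]; exact gap_le_one M x)

lemma ofReal_meanReward (M : Model X O) (x : X) :
    ENNReal.ofReal (meanReward M x) = ∫⁻ z, ENNReal.ofReal (z.1 : ℝ) ∂(M.1 x) :=
  ofReal_integral_eq_lintegral_ofReal (integrable_reward M x)
    (Filter.Eventually.of_forall fun z => z.1.2.1)

/-- A difference `d` of mean rewards forces a squared Hellinger distance of `d² / 4`. -/
lemma ofReal_sq_le_hellingerSq (M N : Model X O) (x : X) {d : ℝ} (hd : 0 ≤ d)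
    (h : d ≤ meanReward M x - meanReward N x) :
    ENNReal.ofReal (d ^ 2 / 4) ≤ hellingerSq (M.1 x) (N.1 x) := by
  rcases hd.eq_or_lt with rfl | hd
  · simp
  by_contra! hlt
  have hfin : hellingerSq (M.1 x) (N.1 x) ≠ ∞ := hlt.ne_top
  set H := (hellingerSq (M.1 x) (N.1 x)).toReal with hH
  have hH0 : 0 ≤ H := ENNReal.toReal_nonneg
  have hHe : hellingerSq (M.1 x) (N.1 x) = ENNReal.ofReal H := (ENNReal.ofReal_toReal hfin).symm
  have hHlt : H < d ^ 2 / 4 := by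
    rw [hHe] at hlt
    exact (ENNReal.ofReal_lt_ofReal_iff (by positivity)).1 hlt
  -- With `s = d / 4` the additive term is `d / 2`, so the Hellinger term `(2 / d) * H` has to cover
  -- the other half of `d`.
  have key := lintegral_le_add_hellingerSq (M.1 x) (N.1 x)
    (f := fun z : unitInterval × O => (z.1 : ℝ)) (by fun_prop) (fun z => z.1.2.1)
    (fun z => z.1.2.2) (s := d / 4) (by positivity)
  rw [← ofReal_meanReward, ← ofReal_meanReward, hHe, ← ENNReal.ofReal_mul (by positivity),
    ← ENNReal.ofReal_add (by positivity) (by positivity),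
    ← ENNReal.ofReal_add (meanReward_nonneg N x) (by positivity),
    ENNReal.ofReal_le_ofReal_iff (add_nonneg (meanReward_nonneg N x) (by positivity))] at key
  have h1 : 1 / (2 * (d / 4)) * H < d / 2 := by
    have : 1 / (2 * (d / 4)) * (d ^ 2 / 4) = d / 2 := by field_simp
    rw [← this]
    exact mul_lt_mul_of_pos_left hHlt (by positivity)
  linarith

end MeanReward

/-! ### Jointly measurable likelihood ratios -/

section LikelihoodRatio

variable {X Z : Type*} [MeasurableSpace X] [MeasurableSpace Z]

/-- Passing from `σ` to `τ ≪ σ` multiplies both joint laws by the same function of the decision, so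
one density serves every such `τ`. -/
lemma exists_density_compProd (σ : Measure X) [IsFiniteMeasure σ] (M K : Kernel X Z)
    [IsFiniteKernel M] [IsFiniteKernel K] (h : σ ⊗ₘ M ≪ σ ⊗ₘ K) :
    ∃ a : X × Z → ℝ≥0, Measurable a ∧ ∀ τ : Measure X, IsFiniteMeasure τ → τ ≪ σ →
      ∀ f : X × Z → ℝ≥0∞, Measurable f → ∫⁻ z, f z ∂(τ ⊗ₘ M) = ∫⁻ z, f z * a z ∂(τ ⊗ₘ K) := by
  refine ⟨fun z => ((σ ⊗ₘ M).rnDeriv (σ ⊗ₘ K) z).toNNReal, by fun_prop, ?_⟩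
  set a : X × Z → ℝ≥0 := fun z => ((σ ⊗ₘ M).rnDeriv (σ ⊗ₘ K) z).toNNReal with ha
  have ham : Measurable a := by fun_prop
  have base : ∀ f : X × Z → ℝ≥0∞, Measurable f →
      ∫⁻ z, f z ∂(σ ⊗ₘ M) = ∫⁻ z, f z * a z ∂(σ ⊗ₘ K) := by
    intro f hf
    rw [← lintegral_rnDeriv_mul h hf.aemeasurable]
    refine lintegral_congr_ae ?_
    filter_upwards [(σ ⊗ₘ M).rnDeriv_lt_top (σ ⊗ₘ K)] with z hz
    rw [ha, ENNReal.coe_toNNReal hz.ne, mul_comm]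
  intro τ hτ hτσ f hf
  have tilt : ∀ (L : Kernel X Z) [IsFiniteKernel L] (g : X × Z → ℝ≥0∞), Measurable g →
      ∫⁻ z, g z ∂(τ ⊗ₘ L) = ∫⁻ z, τ.rnDeriv σ z.1 * g z ∂(σ ⊗ₘ L) := by
    intro L _ g hg
    rw [Measure.lintegral_compProd hg, Measure.lintegral_compProd (by fun_prop),
      ← lintegral_rnDeriv_mul hτσ hg.lintegral_kernel_prod_right'.aemeasurable]
    exact lintegral_congr fun x =>
      (lintegral_const_mul _ (hg.comp measurable_prodMk_left)).symm
  rw [tilt M f hf, tilt K _ (by fun_prop), base _ (by fun_prop)]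
  simp only [mul_assoc]

/-- A likelihood ratio of `M` with respect to `N` that is jointly measurable and valid for every
decision distribution absolutely continuous with respect to `σ`. -/
structure IsLikelihoodRatio (σ : Measure X) (M N : Kernel X Z) (r : X × Z → ℝ≥0) : Prop where
  measurable : Measurable r
  exists_densities : ∃ (K : Kernel X Z) (a b : X × Z → ℝ≥0), IsFiniteKernel K ∧ Measurable a ∧
    Measurable b ∧ (∀ z, r z * b z ≤ a z) ∧
    ∀ τ : Measure X, IsFiniteMeasure τ → τ ≪ σ → ∀ f : X × Z → ℝ≥0∞, Measurable f →
      ∫⁻ z, f z ∂(τ ⊗ₘ M) = ∫⁻ z, f z * a z ∂(τ ⊗ₘ K) ∧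
      ∫⁻ z, f z ∂(τ ⊗ₘ N) = ∫⁻ z, f z * b z ∂(τ ⊗ₘ K)

/-- There is a likelihood ratio whose affinity is controlled by the lower integral of the squared
Hellinger distance. -/
lemma exists_isLikelihoodRatio (σ : Measure X) [IsFiniteMeasure σ] (M N : Kernel X Z)
    [IsMarkovKernel M] [IsMarkovKernel N] :
    ∃ r : X × Z → ℝ≥0, IsLikelihoodRatio σ M N r ∧
      2 * σ Set.univ ≤ ∫⁻ x, hellingerSq (M x) (N x) ∂σ
        + 2 * ∫⁻ z, (NNReal.sqrt (r z) : ℝ≥0∞) ∂(σ ⊗ₘ N) := by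
  have hM : σ ⊗ₘ M ≪ σ ⊗ₘ (M + N) := by
    rw [Measure.compProd_add_right]
    exact Measure.AbsolutelyContinuous.rfl.add_right _
  have hN : σ ⊗ₘ N ≪ σ ⊗ₘ (M + N) := by
    rw [Measure.compProd_add_right, add_comm]
    exact Measure.AbsolutelyContinuous.rfl.add_right _
  obtain ⟨a, ham, ha⟩ := exists_density_compProd σ M (M + N) hM
  obtain ⟨b, hbm, hb⟩ := exists_density_compProd σ N (M + N) hN
  refine ⟨fun z => a z / b z, ⟨by fun_prop, M + N, a, b, inferInstance, ham, hbm, ?_, ?_⟩, ?_⟩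
  · intro z
    rcases eq_or_ne (b z) 0 with h | h
    · simp [h]
    · simp [div_mul_cancel₀ _ h]
  · exact fun τ hτ hτσ f hf => ⟨ha τ hτ hτσ f hf, hb τ hτ hτσ f hf⟩
  classical
  -- The optimal test function `√(a / b)`. The value `∞` where `b = 0` costs nothing: `N` has no
  -- mass there and `φ⁻¹ = 0` removes the `M`-mass. Both integrals of the variational bound then
  -- equal the affinity `∫ √r` under `N`.
  set φ : X × Z → ℝ≥0∞ := fun z => if b z = 0 then ∞ else (NNReal.sqrt (a z / b z) : ℝ≥0∞) with hφ
  have hφm : Measurable φ :=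
    Measurable.ite (hbm (measurableSet_singleton 0)) measurable_const (by fun_prop)
  have hpt : ∀ x, 2 ≤ hellingerSq (M x) (N x)
      + (∫⁻ z, (φ (x, z))⁻¹ ∂(M x) + ∫⁻ z, φ (x, z) ∂(N x)) := fun x =>
    two_le_hellingerSq_add (M x) (N x) (hφm.comp measurable_prodMk_left)
  have hint := lintegral_mono (μ := σ) hpt
  have m1 : Measurable fun x => ∫⁻ z, (φ (x, z))⁻¹ ∂(M x) :=
    (hφm.inv).lintegral_kernel_prod_right'
  have m2 : Measurable fun x => ∫⁻ z, φ (x, z) ∂(N x) := hφm.lintegral_kernel_prod_right'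
  -- Additivity needs only the right summand measurable; the Hellinger term stays a lower integral.
  rw [lintegral_const, lintegral_add_right _ (by fun_prop), lintegral_add_right _ m2] at hint
  have e1 : ∫⁻ x, ∫⁻ z, (φ (x, z))⁻¹ ∂(M x) ∂σ = ∫⁻ z, (φ z)⁻¹ ∂(σ ⊗ₘ M) :=
    (Measure.lintegral_compProd (f := fun z => (φ z)⁻¹) hφm.inv).symm
  have e2 : ∫⁻ x, ∫⁻ z, φ (x, z) ∂(N x) ∂σ = ∫⁻ z, φ z ∂(σ ⊗ₘ N) :=
    (Measure.lintegral_compProd hφm).symm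
  have hσ : σ ≪ σ := Measure.AbsolutelyContinuous.rfl
  have e3 : ∫⁻ z, φ z ∂(σ ⊗ₘ N) = ∫⁻ z, (NNReal.sqrt (a z / b z) : ℝ≥0∞) ∂(σ ⊗ₘ N) := by
    rw [hb σ inferInstance hσ _ hφm, hb σ inferInstance hσ _ (by fun_prop)]
    refine lintegral_congr fun z => ?_
    by_cases h : b z = 0 <;> simp [hφ, h]
  have e4 : ∫⁻ z, (φ z)⁻¹ ∂(σ ⊗ₘ M)
      = ∫⁻ z, (NNReal.sqrt (a z / b z) : ℝ≥0∞) ∂(σ ⊗ₘ N) := by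
    rw [ha σ inferInstance hσ (fun z => (φ z)⁻¹) hφm.inv, hb σ inferInstance hσ _ (by fun_prop)]
    refine lintegral_congr fun z => ?_
    by_cases h : b z = 0
    · simp [hφ, h]
    by_cases h' : a z = 0
    · simp [hφ, h, h']
    have hs : NNReal.sqrt (a z / b z) ≠ 0 := by simp [h, h']
    simp only [hφ, h, if_false]
    rw [← ENNReal.coe_inv hs, ← ENNReal.coe_mul, ← ENNReal.coe_mul]
    congr 1
    have h2 : NNReal.sqrt (a z / b z) * NNReal.sqrt (a z / b z) * b z = a z := by
      rw [NNReal.mul_self_sqrt, div_mul_cancel₀ _ h]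
    field_simp
    rw [pow_two, mul_comm (b z), h2]
  rw [e1, e2, e3, e4] at hint
  simpa [two_mul] using hint

variable {H : Type*} [MeasurableSpace H]

lemma lintegral_compProd_prodMkLeft (Q : Measure H) [IsFiniteMeasure Q] (q : Kernel H X)
    [IsFiniteKernel q] (M : Kernel X Z) [IsFiniteKernel M] {f : H × (X × Z) → ℝ≥0∞}
    (hf : Measurable f) :
    ∫⁻ y, f y ∂(Q ⊗ₘ (q ⊗ₖ Kernel.prodMkLeft H M))
      = ∫⁻ h, ∫⁻ x, ∫⁻ z, f (h, (x, z)) ∂(M x) ∂(q h) ∂Q := by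
  rw [Measure.lintegral_compProd hf]
  refine lintegral_congr fun h => ?_
  rw [Kernel.lintegral_compProd _ _ _ (by fun_prop)]
  rfl

lemma lintegral_snd_compProd_prodMkLeft (Q : Measure H) [IsFiniteMeasure Q] (q : Kernel H X)
    [IsFiniteKernel q] (M : Kernel X Z) [IsFiniteKernel M] {f : X × Z → ℝ≥0∞}
    (hf : Measurable f) :
    ∫⁻ y, f y.2 ∂(Q ⊗ₘ (q ⊗ₖ Kernel.prodMkLeft H M)) = ∫⁻ z, f z ∂((q ∘ₘ Q) ⊗ₘ M) := by
  rw [lintegral_compProd_prodMkLeft Q q M (f := fun y => f y.2) (hf.comp measurable_snd),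
    Measure.lintegral_compProd hf,
    Measure.lintegral_bind q.aemeasurable hf.lintegral_kernel_prod_right'.aemeasurable]

lemma lintegral_rectangle_compProd_prodMkLeft (Q : Measure H) [IsFiniteMeasure Q] (q : Kernel H X)
    [IsFiniteKernel q] (M : Kernel X Z) [IsFiniteKernel M] {f : X × Z → ℝ≥0∞}
    (hf : Measurable f) {C : Set H} (hC : MeasurableSet C) :
    ∫⁻ y, C.indicator 1 y.1 * f y.2 ∂(Q ⊗ₘ (q ⊗ₖ Kernel.prodMkLeft H M))
      = ∫⁻ z, f z ∂((q ∘ₘ (Q.restrict C)) ⊗ₘ M) := by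
  have hm : Measurable (C.indicator (1 : H → ℝ≥0∞)) := measurable_one.indicator hC
  rw [← lintegral_snd_compProd_prodMkLeft _ q M hf,
    lintegral_compProd_prodMkLeft _ q M (by fun_prop),
    lintegral_compProd_prodMkLeft _ q M (by fun_prop), ← lintegral_indicator hC]
  refine lintegral_congr fun h => ?_
  by_cases hh : h ∈ C <;> simp [hh]

/-- On a rectangle `C ×ˢ D`, the history enters only through the decision law obtained by
restricting `Q` to `C`, which is still absolutely continuous with respect to `σ`. -/
lemma compProd_prodMkLeft_eq_withDensity (Q : Measure H) [IsFiniteMeasure Q] (q : Kernel H X)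
    [IsMarkovKernel q] (M K : Kernel X Z) [IsFiniteKernel M] [IsFiniteKernel K] {a : X × Z → ℝ≥0}
    (ham : Measurable a) {σ : Measure X} (hσ : q ∘ₘ Q ≪ σ)
    (ha : ∀ τ : Measure X, IsFiniteMeasure τ → τ ≪ σ → ∀ f : X × Z → ℝ≥0∞, Measurable f →
      ∫⁻ z, f z ∂(τ ⊗ₘ M) = ∫⁻ z, f z * a z ∂(τ ⊗ₘ K)) :
    Q ⊗ₘ (q ⊗ₖ Kernel.prodMkLeft H M)
      = (Q ⊗ₘ (q ⊗ₖ Kernel.prodMkLeft H K)).withDensity (fun y => a y.2) := by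
  refine Measure.ext_prod fun {C D} hC hD => ?_
  have hle : q ∘ₘ (Q.restrict C) ≪ σ :=
    (Measure.AbsolutelyContinuous.comp_right Measure.restrict_le_self.absolutelyContinuous q).trans
      hσ
  have hDm : Measurable (D.indicator (1 : X × Z → ℝ≥0∞)) := measurable_one.indicator hD
  have e : ∀ y : H × (X × Z), (C ×ˢ D).indicator (1 : H × (X × Z) → ℝ≥0∞) y
      = C.indicator 1 y.1 * D.indicator 1 y.2 := by
    intro y
    by_cases h1 : y.1 ∈ C <;> by_cases h2 : y.2 ∈ D <;> simp [h1, h2, Set.mem_prod]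
  rw [withDensity_apply _ (hC.prod hD), ← lintegral_indicator_one (hC.prod hD),
    ← lintegral_indicator (hC.prod hD)]
  simp_rw [e]
  rw [lintegral_rectangle_compProd_prodMkLeft Q q M hDm hC, ha _ inferInstance hle _ hDm,
    ← lintegral_rectangle_compProd_prodMkLeft Q q K (by fun_prop) hC]
  refine lintegral_congr fun y => ?_
  by_cases h1 : y.1 ∈ C <;> by_cases h2 : y.2 ∈ D <;> simp [h1, h2, Set.mem_prod]

/-- An inequality only: `r * b ≤ a` discards the part of `M` singular to `N`. -/
lemma IsLikelihoodRatio.lintegral_mul_le {σ : Measure X} {M N : Kernel X Z} [IsFiniteKernel M]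
    [IsFiniteKernel N] {r : X × Z → ℝ≥0} (hr : IsLikelihoodRatio σ M N r) (Q : Measure H)
    [IsFiniteMeasure Q] (q : Kernel H X) [IsMarkovKernel q] (hσ : q ∘ₘ Q ≪ σ)
    {f : H × (X × Z) → ℝ≥0∞} (hf : Measurable f) :
    ∫⁻ y, f y * r y.2 ∂(Q ⊗ₘ (q ⊗ₖ Kernel.prodMkLeft H N))
      ≤ ∫⁻ y, f y ∂(Q ⊗ₘ (q ⊗ₖ Kernel.prodMkLeft H M)) := by
  have hrm := hr.measurable
  obtain ⟨K, a, b, hK, ham, hbm, hab, h⟩ := hr.exists_densities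
  rw [compProd_prodMkLeft_eq_withDensity Q q M K ham hσ fun τ h1 h2 f hf => (h τ h1 h2 f hf).1,
    compProd_prodMkLeft_eq_withDensity Q q N K hbm hσ fun τ h1 h2 f hf => (h τ h1 h2 f hf).2,
    lintegral_withDensity_eq_lintegral_mul _ (by fun_prop) (by fun_prop),
    lintegral_withDensity_eq_lintegral_mul _ (by fun_prop) hf]
  refine lintegral_mono fun y => ?_
  simp only [Pi.mul_apply]
  have : (r y.2 : ℝ≥0∞) * b y.2 ≤ a y.2 := by exact_mod_cast hab y.2
  calc (b y.2 : ℝ≥0∞) * (f y * r y.2) = f y * (r y.2 * b y.2) := by ring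
    _ ≤ f y * a y.2 := by gcongr
    _ = a y.2 * f y := mul_comm _ _

end LikelihoodRatio

/-! ### One-round decrease of the Le Cam affinity -/

lemma leCam_step_real {y ψ : ℝ} (hy : 0 ≤ y) (hψ : 0 ≤ ψ) :
    y ^ 2 / (1 + y ^ 2) + 9 / 2 * ψ ≤ y ^ 2 * ψ ^ 2 / (1 + y ^ 2 * ψ ^ 2)
      + ((9 / 4 + y ^ 2 / (1 + y ^ 2) ^ 2) + (9 / 4 - y ^ 2 / (1 + y ^ 2) ^ 2) * ψ ^ 2) := by
  -- Taylor expansion in `ψ` at `1`, with exact remainder; `y` and `ψ` stand for `√l` and `√r`.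
  have key : y ^ 2 * ψ ^ 2 / (1 + y ^ 2 * ψ ^ 2) - y ^ 2 / (1 + y ^ 2)
      = 2 * y ^ 2 / (1 + y ^ 2) ^ 2 * (ψ - 1) + (ψ - 1) ^ 2 *
        (y ^ 2 * (1 - y ^ 2 - 2 * y ^ 2 * ψ) / ((1 + y ^ 2) ^ 2 * (1 + y ^ 2 * ψ ^ 2))) := by
    field_simp
    ring
  have hb : -2 ≤ y ^ 2 * (1 - y ^ 2 - 2 * y ^ 2 * ψ)
      / ((1 + y ^ 2) ^ 2 * (1 + y ^ 2 * ψ ^ 2)) := by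
    rw [le_div_iff₀ (by positivity)]
    have h1 : 2 * (y * ψ) ≤ 1 + y ^ 2 * ψ ^ 2 := by nlinarith [sq_nonneg (y * ψ - 1)]
    have h2 : y ^ 3 ≤ (1 + y ^ 2) ^ 2 := by
      nlinarith [sq_nonneg (y ^ 2 - y), sq_nonneg y, sq_nonneg (y ^ 2)]
    have h3 : y ^ 3 * (2 * (y * ψ)) ≤ (1 + y ^ 2) ^ 2 * (1 + y ^ 2 * ψ ^ 2) :=
      mul_le_mul h2 h1 (by positivity) (by positivity)
    have h4 : y ^ 4 * 1 ≤ (1 + y ^ 2) ^ 2 * (1 + y ^ 2 * ψ ^ 2) :=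
      mul_le_mul (by nlinarith [sq_nonneg y]) (by nlinarith [sq_nonneg (y * ψ)]) zero_le_one
        (by positivity)
    nlinarith [sq_nonneg y]
  have hg : y ^ 2 / (1 + y ^ 2) ^ 2 ≤ 1 / 4 := by
    rw [div_le_div_iff₀ (by positivity) (by norm_num)]
    nlinarith [sq_nonneg (y ^ 2 - 1)]
  have hdiv : 2 * y ^ 2 / (1 + y ^ 2) ^ 2 = 2 * (y ^ 2 / (1 + y ^ 2) ^ 2) := by ring
  rw [hdiv] at key
  set G := y ^ 2 / (1 + y ^ 2) ^ 2
  -- Since `2G(ψ - 1) = G(ψ² - 1) - G(ψ - 1)²`, the total loss is at most `(2 + G)(ψ - 1)²` with `G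
  -- ≤ 1 / 4`; this is the origin of `9 / 4`.
  have h5 := mul_le_mul_of_nonneg_left hb (sq_nonneg (ψ - 1))
  nlinarith [mul_nonneg (sub_nonneg.2 hg) (sq_nonneg (ψ - 1))]

/-- With `l` a likelihood ratio, the integral of `l / (1 + l)` is the Le Cam affinity. -/
noncomputable def leCam (l : ℝ≥0) : ℝ≥0 := l / (1 + l)

lemma measurable_leCam : Measurable leCam := by
  unfold leCam
  fun_prop

lemma leCam_le_self (l : ℝ≥0) : leCam l ≤ l :=
  div_le_self zero_le le_self_add

lemma leCam_le_one (l : ℝ≥0) : leCam l ≤ 1 :=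
  div_le_one_of_le₀ le_add_self zero_le

/-- A second order expansion of `leCam` around a likelihood ratio `l`, for a multiplicative
perturbation `r`. -/
lemma exists_leCam_expansion :
    ∃ G W : ℝ≥0 → ℝ≥0, Measurable G ∧ Measurable W ∧ (∀ l, G l + W l = 9 / 2) ∧
      ∀ l r, leCam l + 9 / 2 * NNReal.sqrt r ≤ leCam (l * r) + (G l + W l * r) := by
  have hle : ∀ l : ℝ≥0, l / (1 + l) ^ 2 ≤ 9 / 4 := by
    intro l
    have h1 : l / (1 + l) ^ 2 ≤ 1 := by
      refine div_le_one_of_le₀ ?_ zero_le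
      rw [← NNReal.coe_le_coe]
      push_cast
      nlinarith [l.2, sq_nonneg (l : ℝ)]
    refine h1.trans ?_
    rw [← NNReal.coe_le_coe]
    push_cast
    norm_num
  refine ⟨fun l => 9 / 4 + l / (1 + l) ^ 2, fun l => 9 / 4 - l / (1 + l) ^ 2, by fun_prop,
    by fun_prop, fun l => ?_, fun l r => ?_⟩
  · rw [← NNReal.coe_inj]
    push_cast [NNReal.coe_sub (hle l)]
    ring
  · have h := leCam_step_real (Real.sqrt_nonneg (l : ℝ)) (Real.sqrt_nonneg (r : ℝ))
    rw [Real.sq_sqrt (NNReal.coe_nonneg l), Real.sq_sqrt (NNReal.coe_nonneg r)] at h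
    rw [← NNReal.coe_le_coe]
    push_cast [NNReal.coe_sub (hle l), leCam]
    exact h

section Step

variable {X Z H : Type*} [MeasurableSpace X] [MeasurableSpace Z] [MeasurableSpace H]

lemma lintegral_fst_compProd (Q : Measure H) [SFinite Q] (κ : Kernel H X) [IsMarkovKernel κ]
    {f : H → ℝ≥0∞} (hf : Measurable f) : ∫⁻ y, f y.1 ∂(Q ⊗ₘ κ) = ∫⁻ h, f h ∂Q := by
  rw [Measure.lintegral_compProd (f := fun y => f y.1) (hf.comp measurable_fst)]
  simp

/-- One round decreases the Le Cam affinity by at most a multiple of one minus the conditional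
Hellinger affinity. -/
lemma IsLikelihoodRatio.lintegral_leCam_step {σ : Measure X} {M N : Kernel X Z} [IsMarkovKernel M]
    [IsMarkovKernel N] {r : X × Z → ℝ≥0} (hr : IsLikelihoodRatio σ M N r) (Q : Measure H)
    [IsProbabilityMeasure Q] (q : Kernel H X) [IsMarkovKernel q] (hσ : q ∘ₘ Q ≪ σ)
    {l : H → ℝ≥0} (hl : Measurable l) :
    ∫⁻ h, (leCam (l h) : ℝ≥0∞) ∂Q
        + 9 / 2 * ∫⁻ z, (NNReal.sqrt (r z) : ℝ≥0∞) ∂((q ∘ₘ Q) ⊗ₘ N)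
      ≤ ∫⁻ y, (leCam (l y.1 * r y.2) : ℝ≥0∞) ∂(Q ⊗ₘ (q ⊗ₖ Kernel.prodMkLeft H N)) + 9 / 2 := by
  obtain ⟨G, W, hG, hW, hGW, hstep⟩ := exists_leCam_expansion
  have hrm := hr.measurable
  have hF := measurable_leCam
  have e92 : ((9 / 2 : ℝ≥0) : ℝ≥0∞) = 9 / 2 := by
    rw [ENNReal.coe_div (by norm_num)]; norm_num
  have mF : Measurable fun h => (leCam (l h) : ℝ≥0∞) := by fun_prop
  have mG : Measurable fun h => (G (l h) : ℝ≥0∞) := by fun_prop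
  have mW : Measurable fun h => (W (l h) : ℝ≥0∞) := by fun_prop
  have hpt : ∀ y : H × (X × Z),
      (leCam (l y.1) : ℝ≥0∞) + 9 / 2 * (NNReal.sqrt (r y.2) : ℝ≥0∞)
        ≤ leCam (l y.1 * r y.2) + (G (l y.1) + W (l y.1) * r y.2) := by
    intro y
    rw [← e92]
    exact_mod_cast hstep (l y.1) (r y.2)
  have hint := lintegral_mono (μ := Q ⊗ₘ (q ⊗ₖ Kernel.prodMkLeft H N)) hpt
  rw [lintegral_add_left (by fun_prop), lintegral_const_mul _ (by fun_prop),
    lintegral_add_left (by fun_prop), lintegral_add_left (by fun_prop),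
    lintegral_fst_compProd _ _ mF, lintegral_fst_compProd _ _ mG,
    lintegral_snd_compProd_prodMkLeft Q q N
      (f := fun z => (NNReal.sqrt (r z) : ℝ≥0∞)) (by fun_prop)] at hint
  refine hint.trans ?_
  gcongr
  -- Given the history, `r` has mean at most one under `N`, so the weight of `W * r` is at most that
  -- of `W`.
  have h1 := hr.lintegral_mul_le Q q hσ (f := fun y => (W (l y.1) : ℝ≥0∞)) (by fun_prop)
  rw [lintegral_fst_compProd _ _ mW] at h1
  calc ∫⁻ h, (G (l h) : ℝ≥0∞) ∂Q
        + ∫⁻ y, (W (l y.1) : ℝ≥0∞) * r y.2 ∂(Q ⊗ₘ (q ⊗ₖ Kernel.prodMkLeft H N))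
      ≤ ∫⁻ h, (G (l h) : ℝ≥0∞) ∂Q + ∫⁻ h, (W (l h) : ℝ≥0∞) ∂Q := by gcongr
    _ = ∫⁻ _, (9 / 2 : ℝ≥0∞) ∂Q := by
        rw [← lintegral_add_left mG]
        refine lintegral_congr fun h => ?_
        rw [← e92]
        exact_mod_cast hGW (l h)
    _ = 9 / 2 := by simp

end Step

/-! ### Likelihoods along histories and testing -/

section History

universe u v

variable {X : Type u} {O : Type v} [MeasurableSpace X] [MeasurableSpace O]

lemma isProbabilityMeasure_historyLaw {q : (t : ℕ) → Kernel (History X O t) X}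
    (hq : ∀ t, IsMarkovKernel (q t)) (M : Model X O) (t : ℕ) :
    IsProbabilityMeasure (historyLaw q M t) := by
  induction t with
  | zero => exact Measure.dirac.isProbabilityMeasure (x := PUnit.unit)
  | succ t ih =>
    have := hq t
    exact inferInstanceAs (IsProbabilityMeasure
      ((historyLaw q M t) ⊗ₘ ((q t) ⊗ₖ (Kernel.prodMkLeft (History X O t) M.1))))

/-- The product of the one-round likelihood ratios along a history. -/
def likelihoodProcess (r : X × (unitInterval × O) → ℝ≥0) : (t : ℕ) → History X O t → ℝ≥0
  | 0 => fun _ => 1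
  | t + 1 => fun h => likelihoodProcess r t h.1 * r h.2

lemma measurable_likelihoodProcess {r : X × (unitInterval × O) → ℝ≥0} (hr : Measurable r) (t : ℕ) :
    Measurable (likelihoodProcess r t) := by
  induction t with
  | zero => exact measurable_const
  | succ t ih => exact (ih.comp measurable_fst).mul (hr.comp measurable_snd)

variable {q : (t : ℕ) → Kernel (History X O t) X} {M N : Model X O} {σ : Measure X}
  {r : X × (unitInterval × O) → ℝ≥0}

lemma lintegral_likelihoodProcess_mul_le (hq : ∀ t, IsMarkovKernel (q t))
    (hr : IsLikelihoodRatio σ M.1 N.1 r) (t : ℕ)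
    (hσ : ∀ s < t, q s ∘ₘ historyLaw q N s ≪ σ) {f : History X O t → ℝ≥0∞} (hf : Measurable f) :
    ∫⁻ h, f h * likelihoodProcess r t h ∂(historyLaw q N t) ≤ ∫⁻ h, f h ∂(historyLaw q M t) := by
  induction t with
  | zero => simp [likelihoodProcess, historyLaw]
  | succ t ih =>
    have := hq t
    have := isProbabilityMeasure_historyLaw hq N t
    have := isProbabilityMeasure_historyLaw hq M t
    have hl := measurable_likelihoodProcess hr.measurable t
    have hf' : Measurable (fun y : History X O t × (X × (unitInterval × O)) => f y) := hf
    have h1 := hr.lintegral_mul_le (historyLaw q N t) (q t) (hσ t t.lt_succ_self)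
      (f := fun y => f y * likelihoodProcess r t y.1) (by fun_prop)
    rw [lintegral_compProd_prodMkLeft _ _ M.1 (by fun_prop)] at h1
    have hm : Measurable fun h : History X O t =>
        ∫⁻ y, f (h, y) ∂((q t ⊗ₖ Kernel.prodMkLeft (History X O t) M.1) h) :=
      hf'.lintegral_kernel_prod_right'
    have h2 := ih (fun s hs => hσ s (hs.trans t.lt_succ_self)) hm
    rw [← Measure.lintegral_compProd hf'] at h2
    refine le_trans (le_of_eq ?_) (h1.trans (le_trans (le_of_eq ?_) h2))
    · refine lintegral_congr fun y => ?_
      simp only [likelihoodProcess]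
      push_cast
      ring
    · refine lintegral_congr fun h => ?_
      rw [Kernel.lintegral_compProd _ _ _ (by fun_prop)]
      simp only [Kernel.prodMkLeft_apply]
      rw [← lintegral_mul_const _ (by fun_prop)]
      refine lintegral_congr fun x => ?_
      rw [← lintegral_mul_const _ (by fun_prop)]

/-- The one-round losses telescope from `leCam 1 = 1 / 2`. -/
lemma half_add_le_lintegral_leCam (hq : ∀ t, IsMarkovKernel (q t))
    (hr : IsLikelihoodRatio σ M.1 N.1 r) (t : ℕ)
    (hσ : ∀ s < t, q s ∘ₘ historyLaw q N s ≪ σ) :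
    1 / 2 + 9 / 2 * ∑ s ∈ Finset.range t,
        ∫⁻ z, (NNReal.sqrt (r z) : ℝ≥0∞) ∂((q s ∘ₘ historyLaw q N s) ⊗ₘ N.1)
      ≤ ∫⁻ h, (leCam (likelihoodProcess r t h) : ℝ≥0∞) ∂(historyLaw q N t) + 9 / 2 * t := by
  induction t with
  | zero =>
    have : leCam 1 = 2⁻¹ := by
      unfold leCam; rw [one_add_one_eq_two, one_div]
    have := isProbabilityMeasure_historyLaw hq N 0
    simp [likelihoodProcess, ‹leCam 1 = 2⁻¹›]
  | succ t ih =>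
    have := hq t
    have := isProbabilityMeasure_historyLaw hq N t
    have h1 := hr.lintegral_leCam_step (historyLaw q N t) (q t) (hσ t t.lt_succ_self)
      (measurable_likelihoodProcess hr.measurable t)
    have h2 := ih fun s hs => hσ s (hs.trans t.lt_succ_self)
    rw [Finset.sum_range_succ, mul_add, ← add_assoc]
    refine (add_le_add_left h2 _).trans ?_
    rw [add_right_comm]
    refine (add_le_add_left h1 _).trans (le_of_eq ?_)
    push_cast
    rw [mul_add, mul_one, add_assoc, add_comm (9 / 2 : ℝ≥0∞)]
    rfl

/-- A log-free subadditivity of the squared Hellinger distance over rounds, as a lower bound on the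
sum of the errors of a test between `M` and `N`. The lower integral of the Hellinger distance
suffices. -/
lemma testing_lower_bound (hq : ∀ t, IsMarkovKernel (q t)) (M N : Model X O) (T : ℕ)
    {φ : History X O T → ℝ≥0∞} (hφ : Measurable φ) (hφ1 : ∀ h, φ h ≤ 1) :
    1 / 2 ≤ ∫⁻ h, φ h ∂(historyLaw q M T) + ∫⁻ h, (1 - φ h) ∂(historyLaw q N T)
      + 9 / 4 * expHellingerSq (∑ s ∈ Finset.range T, q s ∘ₘ historyLaw q N s) M N := by
  have hP : ∀ s, IsProbabilityMeasure (q s ∘ₘ historyLaw q N s) := fun s => by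
    have := hq s
    have := isProbabilityMeasure_historyLaw hq N s
    infer_instance
  set σ : Measure X := ∑ s ∈ Finset.range T, q s ∘ₘ historyLaw q N s with hσdef
  obtain ⟨r, hr, haff⟩ := exists_isLikelihoodRatio σ M.1 N.1
  have hσ : ∀ s < T, q s ∘ₘ historyLaw q N s ≪ σ := fun s hs A hA => by
    rw [hσdef, Measure.finsetSum_apply] at hA
    exact (Finset.sum_eq_zero_iff.1 hA) s (Finset.mem_range.2 hs)
  have hrm := hr.measurable
  have hsum : ∫⁻ z, (NNReal.sqrt (r z) : ℝ≥0∞) ∂(σ ⊗ₘ N.1) = ∑ s ∈ Finset.range T,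
      ∫⁻ z, (NNReal.sqrt (r z) : ℝ≥0∞) ∂((q s ∘ₘ historyLaw q N s) ⊗ₘ N.1) := by
    have hm : Measurable fun z : X × (unitInterval × O) => (NNReal.sqrt (r z) : ℝ≥0∞) := by
      fun_prop
    rw [Measure.lintegral_compProd hm, hσdef, lintegral_finsetSum_measure]
    exact Finset.sum_congr rfl fun s _ => (Measure.lintegral_compProd hm).symm
  have huniv : σ Set.univ = T := by
    rw [hσdef, Measure.finsetSum_apply]
    simp
  have h1 := half_add_le_lintegral_leCam hq hr T hσ
  rw [← hsum] at h1
  rw [huniv] at haff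
  set S := ∫⁻ z, (NNReal.sqrt (r z) : ℝ≥0∞) ∂(σ ⊗ₘ N.1)
  set E := expHellingerSq σ M N with hE
  change 2 * (T : ℝ≥0∞) ≤ E + 2 * S at haff
  have hl := measurable_likelihoodProcess hrm T
  have hF := measurable_leCam
  -- `leCam l` is at most both `l` and `1`, hence at most `φ * l + (1 - φ)`; the factor `l` turns
  -- `N` into `M`.
  have h2 : ∫⁻ h, (leCam (likelihoodProcess r T h) : ℝ≥0∞) ∂(historyLaw q N T)
      ≤ ∫⁻ h, φ h ∂(historyLaw q M T) + ∫⁻ h, (1 - φ h) ∂(historyLaw q N T) := by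
    refine le_trans ?_ (add_le_add_left (lintegral_likelihoodProcess_mul_le hq hr T hσ hφ) _)
    rw [← lintegral_add_left (by fun_prop)]
    refine lintegral_mono fun h => ?_
    set c := leCam (likelihoodProcess r T h)
    calc (c : ℝ≥0∞) = φ h * c + (1 - φ h) * c := by
          rw [← add_mul, add_tsub_cancel_of_le (hφ1 h), one_mul]
      _ ≤ φ h * likelihoodProcess r T h + (1 - φ h) * 1 := by
          gcongr
          · exact leCam_le_self _
          · exact ENNReal.coe_le_one_iff.2 (leCam_le_one _)
      _ = _ := by rw [mul_one]
  set L := ∫⁻ h, (leCam (likelihoodProcess r T h) : ℝ≥0∞) ∂(historyLaw q N T)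
  refine le_trans ?_ (add_le_add_left h2 _)
  have e94 : (9 / 4 : ℝ≥0∞) * 2 = 9 / 2 := by
    rw [ENNReal.eq_div_iff (by norm_num) (by norm_num)]
    have : (9 / 4 : ℝ≥0∞) * 4 = 9 := ENNReal.div_mul_cancel (by norm_num) (by norm_num)
    rw [mul_left_comm, show (2 : ℝ≥0∞) * 2 = 4 by norm_num, this]
  have h3 : 9 / 2 * (T : ℝ≥0∞) ≤ 9 / 4 * E + 9 / 2 * S := by
    calc 9 / 2 * (T : ℝ≥0∞) = 9 / 4 * (2 * T) := by rw [← e94, mul_assoc]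
      _ ≤ 9 / 4 * (E + 2 * S) := by gcongr
      _ = _ := by rw [mul_add, ← mul_assoc, e94]
  -- Needed to cancel the affinity sum in `ℝ≥0∞`.
  have hfin : 9 / 2 * S ≠ ∞ := by
    intro htop
    rw [htop, add_top] at h1
    have : L ≤ 1 := by
      have := isProbabilityMeasure_historyLaw hq N T
      calc L ≤ ∫⁻ _, 1 ∂(historyLaw q N T) :=
            lintegral_mono fun h => ENNReal.coe_le_one_iff.2 (leCam_le_one _)
        _ = 1 := by simp
    have hne : L + 9 / 2 * (T : ℝ≥0∞) ≠ ∞ := ENNReal.add_ne_top.2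
      ⟨(this.trans_lt ENNReal.one_lt_top).ne, ENNReal.mul_ne_top
        (ENNReal.div_ne_top (by norm_num) (by norm_num)) (ENNReal.natCast_ne_top T)⟩
    exact hne (top_le_iff.1 h1)
  refine (ENNReal.add_le_add_iff_right hfin).1 ?_
  calc 1 / 2 + 9 / 2 * S ≤ L + 9 / 2 * T := h1
    _ ≤ L + (9 / 4 * E + 9 / 2 * S) := by gcongr
    _ = _ := (add_assoc _ _ _).symm

end History

-- From Hellinger distance to reward differences

universe u v

variable {X : Type u} {O : Type v} [MeasurableSpace X] [MeasurableSpace O]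

lemma ofReal_sq_mul_measure_le_expHellingerSq (p : Measure X) (M N : Model X O) {d : ℝ}
    (hd : 0 ≤ d) :
    ENNReal.ofReal (d ^ 2 / 4) * p {x | d ≤ meanReward M x - meanReward N x}
      ≤ expHellingerSq p M N := by
  have hm : MeasurableSet {x | d ≤ meanReward M x - meanReward N x} :=
    measurableSet_le measurable_const ((measurable_meanReward M).sub (measurable_meanReward N))
  rw [← lintegral_indicator_const hm]
  refine lintegral_mono fun x => ?_
  by_cases hx : d ≤ meanReward M x - meanReward N x
  · rw [Set.indicator_of_mem (show x ∈ {x | d ≤ meanReward M x - meanReward N x} from hx)]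
    exact ofReal_sq_le_hellingerSq M N x hd hx
  · rw [Set.indicator_of_notMem (show x ∉ {x | d ≤ meanReward M x - meanReward N x} from hx)]
    exact zero_le

lemma expHellingerSq_comm (p : Measure X) (M N : Model X O) :
    expHellingerSq p M N = expHellingerSq p N M := by
  unfold expHellingerSq
  simp_rw [hellingerSq_comm]

/-! ### Elementary properties of the coefficients -/

section DecisionEstimation

lemma integral_gap_mem_Icc (M : Model X O) (p : ProbabilityMeasure X) :
    ∫ x, gap M x ∂(p : Measure X) ∈ Set.Icc (0 : ℝ) 1 := by
  refine ⟨integral_nonneg fun x => gap_nonneg M x, ?_⟩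
  have := integral_mono (integrable_gap M (p : Measure X)) (integrable_const (1 : ℝ))
    fun x => gap_le_one M x
  simpa using this

/-- The risks under `p` of the models of the class that are feasible for `q`. -/
def feasibleRisks (ε : ℝ) (𝓜 : Set (Model X O)) (N : Model X O) (p q : ProbabilityMeasure X) :
    Set ℝ :=
  {v : ℝ | ∃ M ∈ 𝓜, expHellingerSq (q : Measure X) M N ≤ ENNReal.ofReal (ε ^ 2) ∧
    v = ∫ x, gap M x ∂(p : Measure X)}

variable (ε : ℝ) (𝓜 : Set (Model X O)) (N : Model X O) (p q : ProbabilityMeasure X)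

lemma feasibleRisks_subset_Icc : feasibleRisks ε 𝓜 N p q ⊆ Set.Icc 0 1 := by
  rintro _ ⟨M, -, -, rfl⟩
  exact integral_gap_mem_Icc M p

lemma bddAbove_feasibleRisks : BddAbove (feasibleRisks ε 𝓜 N p q) :=
  bddAbove_Icc.mono (feasibleRisks_subset_Icc ε 𝓜 N p q)

lemma sSup_feasibleRisks_nonneg : 0 ≤ sSup (feasibleRisks ε 𝓜 N p q) :=
  Real.sSup_nonneg fun _ hv => (feasibleRisks_subset_Icc ε 𝓜 N p q hv).1

lemma sSup_feasibleRisks_le_one : sSup (feasibleRisks ε 𝓜 N p q) ≤ 1 :=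
  Real.sSup_le (fun _ hv => (feasibleRisks_subset_Icc ε 𝓜 N p q hv).2) zero_le_one

lemma bddBelow_range_sSup_feasibleRisks : BddBelow (Set.range
    fun pq : ProbabilityMeasure X × ProbabilityMeasure X =>
      sSup (feasibleRisks ε 𝓜 N pq.1 pq.2)) :=
  ⟨0, by rintro _ ⟨pq, rfl⟩; exact sSup_feasibleRisks_nonneg ε 𝓜 N pq.1 pq.2⟩

lemma decPAC_le_sSup : decPAC ε 𝓜 N ≤ sSup (feasibleRisks ε 𝓜 N p q) :=
  ciInf_le (bddBelow_range_sSup_feasibleRisks ε 𝓜 N) (p, q)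

lemma decPAC_nonneg : 0 ≤ decPAC ε 𝓜 N :=
  Real.iInf_nonneg fun pq => sSup_feasibleRisks_nonneg ε 𝓜 N pq.1 pq.2

lemma decPAC_le_one : decPAC ε 𝓜 N ≤ 1 := by
  rcases isEmpty_or_nonempty (ProbabilityMeasure X × ProbabilityMeasure X) with h | ⟨⟨p, q⟩⟩
  · unfold decPAC
    rw [Real.iInf_of_isEmpty]
    exact zero_le_one
  · exact (decPAC_le_sSup ε 𝓜 N p q).trans (sSup_feasibleRisks_le_one ε 𝓜 N p q)

lemma decPAC_mono {𝓜 𝓜' : Set (Model X O)} (h : 𝓜 ⊆ 𝓜') : decPAC ε 𝓜 N ≤ decPAC ε 𝓜' N := by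
  refine ciInf_mono (bddBelow_range_sSup_feasibleRisks ε 𝓜 N) fun pq => ?_
  have hsub : feasibleRisks ε 𝓜 N pq.1 pq.2 ⊆ feasibleRisks ε 𝓜' N pq.1 pq.2 := by
    rintro v ⟨M, hM, hv⟩
    exact ⟨M, h hM, hv⟩
  change sSup (feasibleRisks ε 𝓜 N pq.1 pq.2) ≤ sSup (feasibleRisks ε 𝓜' N pq.1 pq.2)
  rcases (feasibleRisks ε 𝓜 N pq.1 pq.2).eq_empty_or_nonempty with he | hne
  · rw [he, Real.sSup_empty]
    exact sSup_feasibleRisks_nonneg ε 𝓜' N pq.1 pq.2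
  · exact csSup_le_csSup (bddAbove_feasibleRisks ε 𝓜' N pq.1 pq.2) hne hsub

lemma bddAbove_range_decPAC_insert :
    BddAbove (Set.range fun N : Model X O => decPAC ε (insert N 𝓜) N) :=
  ⟨1, by rintro _ ⟨N, rfl⟩; exact decPAC_le_one ε _ N⟩

lemma decPACImproper_nonneg : 0 ≤ decPACImproper ε 𝓜 :=
  Real.iSup_nonneg fun N => decPAC_nonneg ε _ N

lemma decPACClass_le_decPACImproper : decPACClass ε 𝓜 ≤ decPACImproper ε 𝓜 :=
  Real.iSup_le (fun N => (decPAC_mono ε N.1 (Set.subset_insert N.1 𝓜)).trans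
    (le_ciSup (bddAbove_range_decPAC_insert ε 𝓜) N.1)) (decPACImproper_nonneg ε 𝓜)

end DecisionEstimation

/-! ### Bounds on the radius -/

lemma log_two_le_logFactor {T : ℕ} (hT : 2 ≤ T) (𝓜 : Set (Model X O)) :
    Real.log 2 ≤ logFactor T 𝓜 := by
  have hV : (2 : ℝ≥0∞) ≤ likelihoodRatioBound 𝓜 := by
    refine le_trans ?_ le_sup_right
    rw [show (2 : ℝ≥0∞) = ENNReal.ofReal 2 by simp]
    refine ENNReal.ofReal_le_ofReal ?_
    have := Real.add_one_le_exp 1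
    linarith
  have h2 : (2 : ℝ≥0∞) ≤ (T : ℝ≥0∞) ⊓ likelihoodRatioBound 𝓜 :=
    le_inf (by exact_mod_cast hT) hV
  have hfin : (T : ℝ≥0∞) ⊓ likelihoodRatioBound 𝓜 ≠ ∞ :=
    (inf_le_left.trans_lt (ENNReal.natCast_lt_top T)).ne
  refine Real.log_le_log two_pos ?_
  simpa using ENNReal.toReal_mono hfin h2

lemma lowerRadius_pos {c : ℝ} (hc : 0 < c) {T : ℕ} (hT : 2 ≤ T) (𝓜 : Set (Model X O)) :
    0 < lowerRadius c T 𝓜 := by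
  have h1 : 0 < logFactor T 𝓜 := (Real.log_pos one_lt_two).trans_le (log_two_le_logFactor hT 𝓜)
  have h2 : (0 : ℝ) < T := by exact_mod_cast (by lia : 0 < T)
  exact div_pos hc (Real.sqrt_pos.2 (mul_pos h2 h1))

lemma mul_lowerRadius_sq_le {c : ℝ} (hc : 0 < c) (hc' : c ≤ 1 / 10) {T : ℕ} (hT : 2 ≤ T)
    (𝓜 : Set (Model X O)) : T * lowerRadius c T 𝓜 ^ 2 ≤ 1 / 36 := by
  have h0 := Real.log_two_gt_d9
  have h1 : 0.69 ≤ logFactor T 𝓜 := by linarith [log_two_le_logFactor hT 𝓜]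
  have h2 : (0 : ℝ) < T := by exact_mod_cast (by lia : 0 < T)
  have h3 : (0 : ℝ) < logFactor T 𝓜 := by linarith
  unfold lowerRadius
  rw [div_pow, Real.sq_sqrt (by positivity)]
  have : (T : ℝ) * (c ^ 2 / (T * logFactor T 𝓜)) = c ^ 2 / logFactor T 𝓜 := by field_simp
  rw [this, div_le_div_iff₀ h3 (by norm_num)]
  nlinarith

/-! ### Output law, reference law and risk -/

section Risk

variable {T : ℕ} (alg : PACAlgorithm X O T)

/-- The law of the final decision. -/
noncomputable def outputLaw (M : Model X O) : Measure X :=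
  alg.output ∘ₘ historyLaw alg.explore M T

lemma isProbabilityMeasure_outputLaw (M : Model X O) : IsProbabilityMeasure (outputLaw alg M) := by
  have := alg.output_markov
  have := isProbabilityMeasure_historyLaw alg.explore_markov M T
  unfold outputLaw
  infer_instance

lemma expectedRisk_eq (M : Model X O) : expectedRisk alg M = ∫ x, gap M x ∂(outputLaw alg M) := by
  have := isProbabilityMeasure_outputLaw alg M
  have h := integrable_gap M (outputLaw alg M)
  unfold outputLaw at h ⊢
  rw [Measure.comp_eq_comp_const_apply] at h ⊢
  rw [Kernel.integral_comp h, Kernel.const_apply]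
  rfl

/-- The distribution of the decision in a round that is chosen uniformly at random, up to the factor
`T`. -/
noncomputable def exploreLaw (M : Model X O) : Measure X :=
  ∑ s ∈ Finset.range T, alg.explore s ∘ₘ historyLaw alg.explore M s

lemma exploreLaw_univ (M : Model X O) : exploreLaw alg M Set.univ = T := by
  have : ∀ s, IsProbabilityMeasure (alg.explore s ∘ₘ historyLaw alg.explore M s) := fun s => by
    have := alg.explore_markov s
    have := isProbabilityMeasure_historyLaw alg.explore_markov M s
    infer_instance
  unfold exploreLaw
  rw [Measure.finsetSum_apply]
  simp

/-- The test accepts with the conditional probability that the output lies in `E`. -/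
lemma half_le_outputLaw_add (M N : Model X O) {E : Set X} (hE : MeasurableSet E) :
    1 / 2 ≤ outputLaw alg M E + outputLaw alg N Eᶜ
      + 9 / 4 * expHellingerSq (exploreLaw alg N) M N := by
  have := alg.output_markov
  have h := testing_lower_bound alg.explore_markov M N T (φ := fun h => alg.output h E)
    (alg.output.measurable_coe hE) fun h => prob_le_one
  unfold outputLaw
  rw [Measure.bind_apply hE alg.output.aemeasurable,
    Measure.bind_apply hE.compl alg.output.aemeasurable]
  simp_rw [prob_compl_eq_one_sub hE]
  exact h

/-- The reference decision distribution: half exploration, a quarter output, a quarter `x₀`. -/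
noncomputable def referenceLaw (N : Model X O) (x₀ : X) : Measure X :=
  (2⁻¹ : ℝ≥0∞) • ((T : ℝ≥0∞)⁻¹ • exploreLaw alg N)
    + ((4⁻¹ : ℝ≥0∞) • outputLaw alg N + (4⁻¹ : ℝ≥0∞) • Measure.dirac x₀)

lemma isProbabilityMeasure_referenceLaw (hT : T ≠ 0) (N : Model X O) (x₀ : X) :
    IsProbabilityMeasure (referenceLaw alg N x₀) := by
  have := isProbabilityMeasure_outputLaw alg N
  refine ⟨?_⟩
  simp only [referenceLaw, Measure.add_apply, Measure.smul_apply, smul_eq_mul, exploreLaw_univ,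
    measure_univ, mul_one]
  rw [ENNReal.inv_mul_cancel (by exact_mod_cast hT) (ENNReal.natCast_ne_top T), mul_one]
  have h : (4⁻¹ : ℝ≥0∞) + 4⁻¹ = 2⁻¹ := by
    rw [← two_mul, show (4 : ℝ≥0∞) = 2 * 2 by norm_num,
      ENNReal.mul_inv (by simp) (by simp), ← mul_assoc,
      ENNReal.mul_inv_cancel (by simp) (by simp), one_mul]
  rw [h, ENNReal.inv_two_add_inv_two]

lemma expHellingerSq_referenceLaw (M N : Model X O) (x₀ : X) :
    expHellingerSq (referenceLaw alg N x₀) M N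
      = 2⁻¹ * ((T : ℝ≥0∞)⁻¹ * expHellingerSq (exploreLaw alg N) M N)
        + (4⁻¹ * expHellingerSq (outputLaw alg N) M N
          + 4⁻¹ * expHellingerSq (Measure.dirac x₀) M N) := by
  simp only [expHellingerSq, referenceLaw, lintegral_add_measure, lintegral_smul_measure,
    smul_eq_mul]

variable {alg} {M N : Model X O} {x₀ : X} {ε : ℝ}

lemma expHellingerSq_exploreLaw_le (hT : T ≠ 0)
    (h : expHellingerSq (referenceLaw alg N x₀) M N ≤ ENNReal.ofReal (ε ^ 2)) :
    expHellingerSq (exploreLaw alg N) M N ≤ ENNReal.ofReal (2 * (T * ε ^ 2)) := by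
  rw [expHellingerSq_referenceLaw] at h
  have h1 := le_self_add.trans h
  rw [ENNReal.inv_mul_le_iff (by simp) (by simp),
    ENNReal.inv_mul_le_iff (by exact_mod_cast hT) (ENNReal.natCast_ne_top T)] at h1
  refine h1.trans (le_of_eq ?_)
  rw [ENNReal.ofReal_mul zero_le_two, ENNReal.ofReal_mul (by positivity)]
  simp [mul_left_comm]

lemma expHellingerSq_outputLaw_le
    (h : expHellingerSq (referenceLaw alg N x₀) M N ≤ ENNReal.ofReal (ε ^ 2)) :
    expHellingerSq (outputLaw alg N) M N ≤ ENNReal.ofReal (4 * ε ^ 2) := by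
  rw [expHellingerSq_referenceLaw] at h
  have h1 := le_self_add.trans (le_add_self.trans h)
  rw [ENNReal.inv_mul_le_iff (by simp) (by simp)] at h1
  refine h1.trans (le_of_eq ?_)
  rw [ENNReal.ofReal_mul (by norm_num)]
  simp

lemma expHellingerSq_dirac_le
    (h : expHellingerSq (referenceLaw alg N x₀) M N ≤ ENNReal.ofReal (ε ^ 2)) :
    expHellingerSq (Measure.dirac x₀) M N ≤ ENNReal.ofReal (4 * ε ^ 2) := by
  rw [expHellingerSq_referenceLaw] at h
  have h1 := le_add_self.trans (le_add_self.trans h)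
  rw [ENNReal.inv_mul_le_iff (by simp) (by simp)] at h1
  refine h1.trans (le_of_eq ?_)
  rw [ENNReal.ofReal_mul (by norm_num)]
  simp

/-- A difference of `5ε` would force a squared Hellinger distance of `25ε² / 4 > 4ε²`. -/
lemma meanReward_sub_lt_of_expHellingerSq_dirac_le (hε : 0 < ε)
    (h : expHellingerSq (Measure.dirac x₀) M N ≤ ENNReal.ofReal (4 * ε ^ 2)) :
    meanReward N x₀ - meanReward M x₀ < 5 * ε := by
  by_contra! hle
  rw [expHellingerSq_comm] at h
  have h1 := (ofReal_sq_mul_measure_le_expHellingerSq (Measure.dirac x₀) N M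
    (d := 5 * ε) (by positivity)).trans h
  have hm : MeasurableSet {x | 5 * ε ≤ meanReward N x - meanReward M x} :=
    measurableSet_le measurable_const ((measurable_meanReward N).sub (measurable_meanReward M))
  rw [Measure.dirac_apply' _ hm,
    Set.indicator_of_mem (show x₀ ∈ {x | 5 * ε ≤ meanReward N x - meanReward M x} from hle),
    Pi.one_apply, mul_one, ENNReal.ofReal_le_ofReal_iff (by positivity)] at h1
  nlinarith [pow_pos hε 2]

/-- If the law of the output puts small mass on decisions that are bad for `M`, then some decision
is good for `M` and has nearly the same mean reward under `N`. -/
lemma exists_gap_le_and_meanReward_sub_lt (hT : T ≠ 0) (hε : 0 < ε) (hTε : T * ε ^ 2 ≤ 1 / 36)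
    (h : expHellingerSq (referenceLaw alg N x₀) M N ≤ ENNReal.ofReal (ε ^ 2)) {δ : ℝ} (hδ : 0 < δ)
    (hrisk : expectedRisk alg M ≤ δ / 8) :
    ∃ x, gap M x < δ ∧ meanReward M x - meanReward N x < 16 * ε := by
  have := isProbabilityMeasure_outputLaw alg M
  have := isProbabilityMeasure_outputLaw alg N
  have hE : MeasurableSet {x | δ ≤ gap M x} := measurableSet_le measurable_const (measurable_gap M)
  set E := {x | δ ≤ gap M x} with hEdef
  set B := {x | 16 * ε ≤ meanReward M x - meanReward N x} with hBdef
  -- Markov's inequality for the gap.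
  have hPE : (outputLaw alg M).real E ≤ 1 / 8 := by
    have h1 := mul_meas_ge_le_integral_of_nonneg (μ := outputLaw alg M)
      (Filter.Eventually.of_forall fun x => gap_nonneg M x) (integrable_gap M _) δ
    rw [← expectedRisk_eq] at h1
    have h2 : δ * (outputLaw alg M).real E ≤ δ * (1 / 8) := by linarith
    exact le_of_mul_le_mul_left h2 hδ
  -- Each point of `B` costs `(16ε)² / 4 = 64ε²`, out of a budget of `4ε²`.
  have hNB : (outputLaw alg N).real B ≤ 1 / 16 := by
    have h1 := (ofReal_sq_mul_measure_le_expHellingerSq (outputLaw alg N) M N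
      (d := 16 * ε) (by positivity)).trans (expHellingerSq_outputLaw_le h)
    rw [← ofReal_measureReal, ← ENNReal.ofReal_mul (by positivity),
      ENNReal.ofReal_le_ofReal_iff (by positivity)] at h1
    have h2 : 64 * ε ^ 2 * (outputLaw alg N).real B ≤ 64 * ε ^ 2 * (1 / 16) := by linarith
    exact le_of_mul_le_mul_left h2 (by positivity)
  -- `1 / 2 - 1 / 8 - (9 / 4) * (1 / 18) = 1 / 4`, which exceeds the mass of `B`.
  have hNE : 1 / 4 ≤ (outputLaw alg N).real Eᶜ := by
    have h1 := half_le_outputLaw_add alg M N hE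
    have h2 : expHellingerSq (exploreLaw alg N) M N ≤ ENNReal.ofReal (1 / 18) :=
      (expHellingerSq_exploreLaw_le hT h).trans (ENNReal.ofReal_le_ofReal (by linarith))
    have e1 : (1 / 2 : ℝ≥0∞) = ENNReal.ofReal (1 / 2) := by
      rw [ENNReal.ofReal_div_of_pos two_pos]; simp
    have e2 : (9 / 4 : ℝ≥0∞) = ENNReal.ofReal (9 / 4) := by
      rw [ENNReal.ofReal_div_of_pos (by norm_num)]; simp
    have h3 := h1.trans (add_le_add_right (mul_le_mul_right h2 (9 / 4)) _)
    rw [← ofReal_measureReal (s := E), ← ofReal_measureReal (s := Eᶜ), e1, e2,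
      ← ENNReal.ofReal_mul (by norm_num), ← ENNReal.ofReal_add (by positivity) (by positivity),
      ← ENNReal.ofReal_add (by positivity) (by positivity),
      ENNReal.ofReal_le_ofReal_iff (by positivity)] at h3
    linarith
  by_contra! hno
  have hsub : Eᶜ ⊆ B := fun x hx => hno x (not_le.1 hx)
  have := measureReal_mono (μ := outputLaw alg N) hsub
  linarith

end Risk

/-- The core of the lower bound, for a fixed reference model. -/
lemma lt_expectedRisk_of_lt_decPAC {T : ℕ} (hT : T ≠ 0) (alg : PACAlgorithm X O T)
    (𝓜 : Set (Model X O)) (N : Model X O) {ε D : ℝ} (hε : 0 < ε) (hTε : T * ε ^ 2 ≤ 1 / 36)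
    (hD : 67 * ε ≤ D) (hdec : 9 / 10 * D < decPAC ε (insert N 𝓜) N) :
    ∃ M ∈ 𝓜, 1 / 32 * D < expectedRisk alg M := by
  have hDpos : 0 < D := by linarith
  have : Nonempty X := by
    have := isProbabilityMeasure_outputLaw alg N
    exact (outputLaw alg N).nonempty_of_neZero
  obtain ⟨x₀, hx₀⟩ : ∃ x₀, (⨆ y, meanReward N y) - D / 10 < meanReward N x₀ :=
    exists_lt_of_lt_ciSup (by linarith)
  have hq := isProbabilityMeasure_referenceLaw alg hT N x₀
  let p : ProbabilityMeasure X := ⟨Measure.dirac x₀, inferInstance⟩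
  let q : ProbabilityMeasure X := ⟨referenceLaw alg N x₀, hq⟩
  have hlt := hdec.trans_le (decPAC_le_sSup ε (insert N 𝓜) N p q)
  have hne : (feasibleRisks ε (insert N 𝓜) N p q).Nonempty := by
    by_contra hemp
    rw [Set.not_nonempty_iff_eq_empty.1 hemp, Real.sSup_empty] at hlt
    linarith
  obtain ⟨_, ⟨M, hM, hH, rfl⟩, hv⟩ := exists_lt_of_lt_csSup hne hlt
  have hgap : 9 / 10 * D < gap M x₀ := by
    rwa [show ((p : ProbabilityMeasure X) : Measure X) = Measure.dirac x₀ from rfl,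
      integral_dirac' _ _ (measurable_gap M).stronglyMeasurable] at hv
  change expHellingerSq (referenceLaw alg N x₀) M N ≤ _ at hH
  -- The gap of `N` at `x₀` is below `D / 10`.
  have hMN : M ≠ N := by
    rintro rfl
    unfold gap at hgap
    linarith
  refine ⟨M, hM.resolve_left hMN, ?_⟩
  by_contra! hrisk
  obtain ⟨x, hx1, hx2⟩ := exists_gap_le_and_meanReward_sub_lt hT hε hTε hH (δ := D / 4)
    (by positivity) (by linarith)
  have h1 := meanReward_sub_lt_of_expHellingerSq_dirac_le hε (expHellingerSq_dirac_le hH)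
  have h2 := le_ciSup (bddAbove_range_meanReward N) x
  unfold gap at hx1 hgap
  -- Chaining the comparisons through `x` and `x₀` gives `(9/10 - 1/10 - 1/4) * D < 21 * ε`,
  -- contrary to `67 * ε ≤ D`.
  linarith

end DMSO

theorem theorem2p1 :
    ∃ c₀ κ : ℝ, 0 < c₀ ∧ 0 < κ ∧
      ∀ (X : Type*) (O : Type*) [MeasurableSpace X] [MeasurableSpace O]
        (𝓜 : Set (DMSO.Model X O)) (c : ℝ) (T : ℕ),
        0 < c → c ≤ c₀ → 2 ≤ T →
        DMSO.decPACClass (DMSO.lowerRadius c T 𝓜) 𝓜 ≥ 48 * √2 * DMSO.lowerRadius c T 𝓜 →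
        (∀ alg : DMSO.PACAlgorithm X O T, ∃ M ∈ 𝓜,
          DMSO.expectedRisk alg M ≥ κ * DMSO.decPACImproper (DMSO.lowerRadius c T 𝓜) 𝓜) ∧
        κ * DMSO.decPACImproper (DMSO.lowerRadius c T 𝓜) 𝓜 ≥
          κ * DMSO.decPACClass (DMSO.lowerRadius c T 𝓜) 𝓜 := by
  -- `c₀ = 1 / 10` makes `T * ε ^ 2 ≤ 1 / 36`; `κ = 1 / 32` is `δ / 8` at `δ = D / 4`.
  refine ⟨1 / 10, 1 / 32, by norm_num, by norm_num, ?_⟩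
  intro X O _ _ 𝓜 c T hc hc' hT hdec
  have hε := DMSO.lowerRadius_pos hc hT 𝓜
  have hTε := DMSO.mul_lowerRadius_sq_le hc hc' hT 𝓜
  have hle := DMSO.decPACClass_le_decPACImproper (DMSO.lowerRadius c T 𝓜) 𝓜
  refine ⟨fun alg => ?_, by linarith⟩
  set ε := DMSO.lowerRadius c T 𝓜
  set D := DMSO.decPACImproper ε 𝓜 with hD
  -- `48 * 1.4 = 67.2`.
  have h67 : 67 * ε ≤ D := by
    have h2 : (1.4 : ℝ) ≤ √2 := Real.le_sqrt_of_sq_le (by norm_num)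
    nlinarith
  have hne : Nonempty (DMSO.Model X O) := by
    by_contra hemp
    rw [not_nonempty_iff] at hemp
    have : D = 0 := Real.iSup_of_isEmpty _
    linarith
  obtain ⟨N, hN⟩ : ∃ N, 9 / 10 * D < DMSO.decPAC ε (insert N 𝓜) N :=
    exists_lt_of_lt_ciSup (by rw [← DMSO.decPACImproper, ← hD]; linarith)
  obtain ⟨M, hM, hlt⟩ := DMSO.lt_expectedRisk_of_lt_decPAC (by lia) alg 𝓜 N hε hTε h67 hN
  exact ⟨M, hM, hlt.le⟩
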